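/- All graphs are finite and simple. A complex (respectively real) realisation of a graph \(G=(V,E)\) is a map \(p:V\to\mathbb C^2\) (respectively \(p:V\to\mathbb R^2\)); it is generic if the family of its \(2|V|\) coordinates is algebraically independent over \(\mathbb Q\). For \(u,v\in V\) with \(p(u)-p(v)=(a,b)\) put \(d_p(u,v)=a^2+b^2\), and let \(d_G(p)=(d_p(u,v))_{uv\in E}\). Two realisations \(p,q\) of \(G\) over the same field are equivalent if \(d_G(p)=d_G(q)\), and congruent if \(d_p(u,v)=d_q(u,v)\) for all \(u,v\in V\). The graph \(G\) is globally rigid if for some (equivalently, every) generic complex realisation \(p\) of \(G\), every complex realisation equivalent to \(p\) is congruent to \(p\). The graph \(G\) is rigid if for every (equivalently, some) generic real realisation \(p\) there is an \(\epsilon>0\) such that every real realisation \(q\) which is equivalent to \(p\) and satisfies \(\|p(v)-q(v)\|^2<\epsilon\) for all \(v\in V\) is congruent to \(p\). For fields \(K\subseteq L\), the extension \(L:K\) is quadratically solvable if there are fields \(K=K_1\subseteq K_2\subseteq\dots\subseteq K_t\) with \(L\subseteq K_t\) such that, for all \(1\le i<t\), \(K_{i+1}=K_i(x_i)\) for some \(x_i\)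 with \(x_i^2\in K_i\). A complex realisation \(p\) of \(G\) is quadratically solvable if there is a complex realisation \(q\) congruent to \(p\) such that \(\mathbb Q(q):\mathbb Q(d_G(q))\) is quadratically solvable, where \(\mathbb Q(q)\) and \(\mathbb Q(d_G(q))\) are the subfields of \(\mathbb C\) generated by the coordinates of \(q\) and by the entries of \(d_G(q)\). The graph \(G\) is quadratically solvable if it is rigid and every (equivalently, some) generic complex realisation of \(G\) is quadratically solvable. Theorem. Every globally rigid graph is quadratically solvable. -/

import Mathlib

namespace PlaneFramework

/-- A realisation of a graph with vertex set `V` in the plane `F²`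
(`F = ℂ`: a complex realisation, `F = ℝ`: a real realisation). -/
abbrev Realisation (F V : Type*) : Type _ := V → Fin 2 → F

/-- The squared distance `d_p(u,v) = a² + b²`, where `(a,b) = p(u) - p(v)`.
Over `ℂ` there is no conjugation and no absolute value. -/
def sqDist {F V : Type*} [CommRing F] (p : Realisation F V) (u v : V) : F :=
  (p u 0 - p v 0) ^ 2 + (p u 1 - p v 1) ^ 2

/-- The framework is generic: the family of all `2|V|` coordinates of its points is
algebraically independent over `ℚ`. -/
def IsGeneric {F V : Type*} [CommRing F] [Algebra ℚ F] (p : Realisation F V) : Prop :=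
  AlgebraicIndependent ℚ (fun x : V × Fin 2 => p x.1 x.2)

/-- `(G,p)` and `(G,q)` are equivalent: all edges have the same squared length. -/
def AreEquivalent {F V : Type*} [CommRing F] (G : SimpleGraph V) (p q : Realisation F V) : Prop :=
  ∀ u v : V, G.Adj u v → sqDist p u v = sqDist q u v

/-- `(G,p)` and `(G,q)` are congruent: all pairs of vertices have the same squared distance. -/
def AreCongruent {F V : Type*} [CommRing F] (p q : Realisation F V) : Prop :=
  ∀ u v : V, sqDist p u v = sqDist q u v

/-- The complex framework `(G,p)` is globally rigid: every equivalent complex framework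
is congruent to it. -/
def IsGloballyRigidAt {V : Type*} (G : SimpleGraph V) (p : Realisation ℂ V) : Prop :=
  ∀ q : Realisation ℂ V, AreEquivalent G p q → AreCongruent p q

/-- The graph `G` is globally rigid: some generic complex realisation is globally rigid.
(It is equivalent to ask this of every generic realisation.) -/
def IsGloballyRigid {V : Type*} (G : SimpleGraph V) : Prop :=
  ∃ p : Realisation ℂ V, IsGeneric p ∧ IsGloballyRigidAt G p

/-- The real framework `(G,p)` is rigid: every equivalent real framework which is
sufficiently close to it is congruent to it. -/
def IsRigidAt {V : Type*} (G : SimpleGraph V) (p : Realisation ℝ V) : Prop :=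
  ∃ ε : ℝ, 0 < ε ∧ ∀ q : Realisation ℝ V, AreEquivalent G p q →
    (∀ v : V, (p v 0 - q v 0) ^ 2 + (p v 1 - q v 1) ^ 2 < ε) → AreCongruent p q

/-- The graph `G` is rigid: every generic real realisation is rigid.
(It is equivalent to ask this of some generic real realisation.) -/
def IsRigid {V : Type*} (G : SimpleGraph V) : Prop :=
  ∀ p : Realisation ℝ V, IsGeneric p → IsRigidAt G p

/-- For subfields `K, M` of `ℂ`: `M` is a quadratic extension of `K`, that is, there is a tower
`K = F₀ ⊆ F₁ ⊆ … ⊆ F_t = M` with `F_{i+1} = F_i(x_i)` and `x_i² ∈ F_i`. -/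
def IsQuadraticExtension (K M : IntermediateField ℚ ℂ) : Prop :=
  ∃ (t : ℕ) (F : ℕ → IntermediateField ℚ ℂ), F 0 = K ∧ F t = M ∧
    ∀ i < t, ∃ x : ℂ, x ^ 2 ∈ F i ∧
      F (i + 1) = (IntermediateField.adjoin (F i) {x}).restrictScalars ℚ

/-- For subfields `K ⊆ L` of `ℂ`: the extension `L : K` is quadratically solvable, that is,
`L` is contained in a quadratic extension of `K`. -/
def IsQuadraticallySolvableExtension (K L : IntermediateField ℚ ℂ) : Prop :=
  K ≤ L ∧ ∃ M : IntermediateField ℚ ℂ, IsQuadraticExtension K M ∧ L ≤ M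

/-- The field `ℚ(p)` generated by all coordinates of all points `p(v)`. -/
noncomputable def coordField {V : Type*} (p : Realisation ℂ V) : IntermediateField ℚ ℂ :=
  IntermediateField.adjoin ℚ {z | ∃ (v : V) (i : Fin 2), z = p v i}

/-- The field `ℚ(d_G(p))` generated by the squared lengths of all edges of `G`. -/
noncomputable def edgeField {V : Type*} (G : SimpleGraph V) (p : Realisation ℂ V) :
    IntermediateField ℚ ℂ :=
  IntermediateField.adjoin ℚ {z | ∃ u v : V, G.Adj u v ∧ z = sqDist p u v}

/-- The complex framework `(G,p)` is quadratically solvable: for some congruent framework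
`(G,q)` the extension `ℚ(q) : ℚ(d_G(q))` is quadratically solvable. -/
def IsQuadraticallySolvableAt {V : Type*} (G : SimpleGraph V) (p : Realisation ℂ V) : Prop :=
  ∃ q : Realisation ℂ V, AreCongruent p q ∧
    IsQuadraticallySolvableExtension (edgeField G q) (coordField q)

/-- The graph `G` is quadratically solvable: it is rigid, and every generic complex realisation
is quadratically solvable. (For a rigid graph it is equivalent to ask this of some generic
realisation.) -/
def IsQuadraticallySolvable {V : Type*} (G : SimpleGraph V) : Prop :=
  IsRigid G ∧ ∀ p : Realisation ℂ V, IsGeneric p → IsQuadraticallySolvableAt G p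

end PlaneFramework

/-!
Automorphisms of `ℂ` act coordinatewise on complex realisations and respect equivalence and
congruence. Since `ℂ` is algebraically closed and uncountable, any isomorphism between countable
subfields of `ℂ` extends to an automorphism (`Complex.exists_ringEquiv_comp_eq`). This has two
consequences.

* Any generic realisation is mapped to any other one by an automorphism of `ℂ`, so in a globally
  rigid graph *every* generic complex realisation is globally rigid
  (`IsGloballyRigid.isGloballyRigidAt`). A generic real realisation is also generic as a complex
  one, so real realisations equivalent to it are congruent to it, wherever they lie: the graph is
  rigid.
* If `p` is a globally rigid realisation, an automorphism fixing the edge lengths maps `p` to an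
  equivalent, hence congruent, realisation, and so fixes all squared distances. The fixed field of
  the automorphisms over a countable subfield is that subfield
  (`Complex.mem_of_forall_ringEquiv`); therefore all squared distances lie in `ℚ(d_G(p))`
  (`IsGloballyRigidAt.sqDist_mem_edgeField`).

It remains to recover coordinates from squared distances, which takes two square roots: one puts
a vector between two vertices on the first axis, and one gives the second coordinate of a point off that axis
(`isQuadraticallySolvableAt_of_sqDist_mem`).
-/

universe u

/-! ### Isomorphisms between uncountable algebraically closed fields -/

/-- Two uncountable algebraically closed fields of the same cardinality are isomorphic over every
countable ring that embeds in both of them: relative transcendence bases have the cardinality of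
the fields, hence can be matched. -/
theorem IsAlgClosed.nonempty_algEquiv_of_countable {R : Type*} {K L : Type u} [CommRing R]
    [Nontrivial R] [Countable R] [Field K] [Field L] [Algebra R K] [Algebra R L]
    [FaithfulSMul R K] [FaithfulSMul R L] [IsAlgClosed K] [IsAlgClosed L]
    (hK : Cardinal.aleph0 < Cardinal.mk K) (hKL : Cardinal.mk K = Cardinal.mk L) :
    Nonempty (K ≃ₐ[R] L) := by
  obtain ⟨s, hs⟩ := exists_isTranscendenceBasis R K
  obtain ⟨t, ht⟩ := exists_isTranscendenceBasis R L
  have hR : Cardinal.mk R ≤ Cardinal.aleph0 := Cardinal.mk_le_aleph0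
  have h₁ := IsAlgClosed.cardinal_eq_cardinal_transcendence_basis_of_aleph0_lt _ hs hR hK
  have h₂ := IsAlgClosed.cardinal_eq_cardinal_transcendence_basis_of_aleph0_lt _ ht hR (hKL ▸ hK)
  rw [Cardinal.lift_id, Cardinal.lift_id] at h₁ h₂
  obtain ⟨e⟩ := Cardinal.eq.1 (h₁.symm.trans (hKL.trans h₂))
  let := IsAlgClosed.isAlgClosure_of_transcendence_basis _ hs
  let := IsAlgClosed.isAlgClosure_of_transcendence_basis _ ht
  let f : Algebra.adjoin R (Set.range ((↑) : s → K)) ≃ₐ[R]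
      Algebra.adjoin R (Set.range ((↑) : t → L)) :=
    hs.1.aevalEquiv.symm.trans ((MvPolynomial.renameEquiv R e).trans ht.1.aevalEquiv)
  refine ⟨AlgEquiv.ofRingEquiv (f := IsAlgClosure.equivOfEquiv K L f.toRingEquiv) fun r ↦ ?_⟩
  have h := IsAlgClosure.equivOfEquiv_algebraMap K L f.toRingEquiv (algebraMap R _ r)
  rw [← IsScalarTower.algebraMap_apply] at h
  rw [h]
  have h' : f.toRingEquiv (algebraMap R _ r) = algebraMap R _ r := f.commutes r
  rw [h', ← IsScalarTower.algebraMap_apply]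

/-- Two embeddings of a countable ring in `ℂ` differ by an automorphism of `ℂ`. -/
theorem Complex.exists_ringEquiv_comp_eq {R : Type*} [CommRing R] [Nontrivial R] [Countable R]
    (f g : R →+* ℂ) (hf : Function.Injective f) (hg : Function.Injective g) :
    ∃ σ : ℂ ≃+* ℂ, ∀ r, σ (f r) = g r := by
  have hC : Cardinal.aleph0 < Cardinal.mk ℂ := by
    rw [Cardinal.mk_complex]; exact Cardinal.aleph0_lt_continuum
  -- The two `R`-algebra structures on `ℂ` have to be passed explicitly.
  let A := f.toAlgebra
  let B := g.toAlgebra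
  have hA : @FaithfulSMul R ℂ A.toSMul := by
    let := A
    exact (faithfulSMul_iff_algebraMap_injective R ℂ).2 hf
  have hB : @FaithfulSMul R ℂ B.toSMul := by
    let := B
    exact (faithfulSMul_iff_algebraMap_injective R ℂ).2 hg
  obtain ⟨σ⟩ := @IsAlgClosed.nonempty_algEquiv_of_countable R ℂ ℂ _ _ _ _ _ A B hA hB _ _ hC rfl
  exact ⟨@AlgEquiv.toRingEquiv R ℂ ℂ _ _ _ A B σ, @AlgEquiv.commutes R ℂ ℂ _ _ _ A B σ⟩

/-- A complex number fixed by all automorphisms of `ℂ` over a countable subfield lies in that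
subfield. -/
theorem Complex.mem_of_forall_ringEquiv {k : Type*} [Field k] [Algebra k ℂ]
    [CharZero k] [Countable k] {x : ℂ}
    (h : ∀ σ : ℂ ≃+* ℂ, (∀ a : k, σ (algebraMap k ℂ a) = algebraMap k ℂ a) → σ x = x) :
    x ∈ (⊥ : Subalgebra k ℂ) := by
  have hcount : Countable (Polynomial k) := by
    rw [← Cardinal.mk_le_aleph0_iff]
    exact Polynomial.cardinalMk_le_max.trans (max_le Cardinal.mk_le_aleph0 le_rfl)
  by_cases hx : IsIntegral k x
  · -- An algebraic `x` outside `k` is moved to another root of its minimal polynomial.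
    by_contra hmem
    obtain ⟨y, hxy, hy⟩ := (notMem_iff_exists_ne_and_isConjRoot
      (minpoly.irreducible hx).separable (IsAlgClosed.splits _)).1 hmem
    have : Fact (Irreducible (minpoly k x)) := ⟨minpoly.irreducible hx⟩
    have : Countable (AdjoinRoot (minpoly k x)) := AdjoinRoot.mk_surjective.countable
    let f : AdjoinRoot (minpoly k x) →+* ℂ :=
      AdjoinRoot.lift (algebraMap k ℂ) x (minpoly.aeval k x)
    let g : AdjoinRoot (minpoly k x) →+* ℂ :=
      AdjoinRoot.lift (algebraMap k ℂ) y hy.aeval_eq_zero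
    obtain ⟨σ, hσ⟩ := Complex.exists_ringEquiv_comp_eq f g f.injective g.injective
    have hσx : σ x = y := by
      rw [← AdjoinRoot.lift_root (minpoly.aeval k x), ← AdjoinRoot.lift_root hy.aeval_eq_zero]
      exact hσ _
    have hσk (a : k) : σ (algebraMap k ℂ a) = algebraMap k ℂ a := by
      have hfa : f (AdjoinRoot.of _ a) = algebraMap k ℂ a := AdjoinRoot.lift_of _
      have hga : g (AdjoinRoot.of _ a) = algebraMap k ℂ a := AdjoinRoot.lift_of _
      rw [← hfa, hσ, hga, hfa]
    exact hxy ((h σ hσk).symm.trans hσx)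
  · -- A transcendental `x` is moved to `x + 1`.
    exfalso
    have hx' : Transcendental k x := fun hx' ↦ hx hx'.isIntegral
    have hx1 : Transcendental k (x + 1) := fun h1 ↦ hx' <| by
      simpa using h1.sub (isAlgebraic_one (R := k) (A := ℂ))
    obtain ⟨σ, hσ⟩ := Complex.exists_ringEquiv_comp_eq (Polynomial.aeval (R := k) x).toRingHom
      (Polynomial.aeval (R := k) (x + 1)).toRingHom (transcendental_iff_injective.1 hx')
      (transcendental_iff_injective.1 hx1)
    have hσx : σ x = x + 1 := by simpa using hσ Polynomial.X
    have := h σ fun a ↦ by simpa using hσ (Polynomial.C a)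
    rw [hσx] at this
    simp at this

namespace PlaneFramework

/-! ### Automorphisms of `ℂ` acting on frameworks -/

theorem map_sqDist {F F' V : Type*} [CommRing F] [CommRing F'] (σ : F →+* F')
    (p : Realisation F V) (u v : V) :
    sqDist (fun w i ↦ σ (p w i)) u v = σ (sqDist p u v) := by
  simp [sqDist]

theorem IsGeneric.ofReal {V : Type*} {p : Realisation ℝ V} (hp : IsGeneric p) :
    IsGeneric (F := ℂ) (fun v i ↦ (p v i : ℂ)) :=
  AlgebraicIndependent.map' (f := (Complex.ofRealAm.restrictScalars ℚ)) hp Complex.ofReal_injective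

theorem IsGeneric.exists_ringEquiv {V : Type*} [Finite V] {p q : Realisation ℂ V}
    (hp : IsGeneric p) (hq : IsGeneric q) : ∃ σ : ℂ ≃+* ℂ, ∀ v i, σ (p v i) = q v i := by
  have hcount : Countable (MvPolynomial (V × Fin 2) ℚ) := by
    rw [← Cardinal.mk_le_aleph0_iff]
    exact MvPolynomial.cardinalMk_le_max_lift.trans (max_le (max_le (by simp)
      (Cardinal.lift_le_aleph0.2 Cardinal.mk_le_aleph0)) le_rfl)
  obtain ⟨σ, hσ⟩ := Complex.exists_ringEquiv_comp_eq
    (MvPolynomial.aeval (R := ℚ) fun x : V × Fin 2 ↦ p x.1 x.2).toRingHom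
    (MvPolynomial.aeval (R := ℚ) fun x : V × Fin 2 ↦ q x.1 x.2).toRingHom hp hq
  exact ⟨σ, fun v i ↦ by simpa using hσ (MvPolynomial.X (v, i))⟩

/-- Global rigidity is a generic property: an automorphism of `ℂ` carries any generic
realisation to any other one and respects equivalence and congruence. -/
theorem IsGloballyRigid.isGloballyRigidAt {V : Type*} [Finite V] {G : SimpleGraph V}
    (hG : IsGloballyRigid G) {p : Realisation ℂ V} (hp : IsGeneric p) :
    IsGloballyRigidAt G p := by
  obtain ⟨p₀, hp₀, hrigid⟩ := hG
  obtain ⟨σ, hσ⟩ := hp.exists_ringEquiv hp₀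
  have hσp (u v : V) : sqDist p₀ u v = σ (sqDist p u v) := by
    rw [← RingEquiv.coe_toRingHom, ← map_sqDist]
    simp [sqDist, hσ]
  intro q hq u v
  have h := hrigid (fun w i ↦ σ (q w i)) (fun u v huv ↦ by
    rw [hσp, hq u v huv]; exact (map_sqDist σ.toRingHom q u v).symm) u v
  rw [hσp] at h
  exact σ.injective (h.trans (map_sqDist σ.toRingHom q u v))

theorem countable_edgeField {V : Type*} [Finite V] (G : SimpleGraph V) (p : Realisation ℂ V) :
    Countable (edgeField G p) := by
  have hS : {z | ∃ u v : V, G.Adj u v ∧ z = sqDist p u v}.Countable :=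
    ((Set.finite_range fun x : V × V ↦ sqDist p x.1 x.2).subset (by
      rintro _ ⟨u, v, -, rfl⟩; exact ⟨(u, v), rfl⟩)).countable
  rw [← Cardinal.mk_le_aleph0_iff]
  refine (Subfield.cardinalMk_closure_le_max _).trans (max_le ?_ le_rfl)
  rw [Cardinal.le_aleph0_iff_set_countable]
  exact (Set.countable_range _).union hS

/-- If `p` is globally rigid then its edge lengths determine all its squared distances rationally:
an automorphism of `ℂ` that fixes the edge lengths maps `p` to an equivalent, hence congruent,
realisation. -/
theorem IsGloballyRigidAt.sqDist_mem_edgeField {V : Type*} [Finite V] {G : SimpleGraph V}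
    {p : Realisation ℂ V} (hp : IsGloballyRigidAt G p) (u v : V) :
    sqDist p u v ∈ edgeField G p := by
  have := countable_edgeField G p
  have key : sqDist p u v ∈ (⊥ : Subalgebra (edgeField G p) ℂ) := by
    refine Complex.mem_of_forall_ringEquiv fun σ hσ ↦ ?_
    have hcongr : AreCongruent p fun w i ↦ σ.toRingHom (p w i) := hp _ fun u v huv ↦ by
      rw [map_sqDist]
      exact (hσ ⟨sqDist p u v, IntermediateField.subset_adjoin _ _ ⟨u, v, huv, rfl⟩⟩).symm
    exact ((hcongr u v).trans (map_sqDist σ.toRingHom p u v)).symm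
  obtain ⟨a, ha⟩ := Algebra.mem_bot.1 key
  exact ha ▸ a.2

/-! ### Coordinates from squared distances -/

theorem AreCongruent.edgeField_eq {V : Type*} {p q : Realisation ℂ V} (h : AreCongruent p q)
    (G : SimpleGraph V) : edgeField G p = edgeField G q := by
  simp only [edgeField, h _ _]

theorem edgeField_le_coordField {V : Type*} (G : SimpleGraph V) (p : Realisation ℂ V) :
    edgeField G p ≤ coordField p := by
  have h (v : V) (i : Fin 2) : p v i ∈ coordField p :=
    IntermediateField.subset_adjoin _ _ ⟨v, i, rfl⟩
  refine IntermediateField.adjoin_le_iff.2 ?_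
  rintro _ ⟨u, v, -, rfl⟩
  exact add_mem (pow_mem (sub_mem (h u 0) (h v 0)) 2) (pow_mem (sub_mem (h u 1) (h v 1)) 2)

/-- Two square roots can be adjoined in turn. -/
theorem exists_isQuadraticExtension_mem_mem {K : IntermediateField ℚ ℂ} {s c : ℂ}
    (hs : s ^ 2 ∈ K) (hc : c ^ 2 ∈ K) :
    ∃ M, IsQuadraticExtension K M ∧ K ≤ M ∧ s ∈ M ∧ c ∈ M := by
  let K₁ : IntermediateField ℚ ℂ := (IntermediateField.adjoin K {s}).restrictScalars ℚ
  let K₂ : IntermediateField ℚ ℂ := (IntermediateField.adjoin K₁ {c}).restrictScalars ℚ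
  have h₁ : K ≤ K₁ := fun x hx ↦
    (IntermediateField.adjoin K {s}).algebraMap_mem ⟨x, hx⟩
  have h₂ : K₁ ≤ K₂ := fun x hx ↦
    (IntermediateField.adjoin K₁ {c}).algebraMap_mem ⟨x, hx⟩
  refine ⟨K₂, ⟨2, fun n ↦ if n = 0 then K else if n = 1 then K₁ else K₂, rfl, rfl, ?_⟩,
    h₁.trans h₂, h₂ (IntermediateField.mem_adjoin_simple_self K s),
    IntermediateField.mem_adjoin_simple_self K₁ c⟩
  intro i hi
  interval_cases i
  · exact ⟨s, hs, rfl⟩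
  · exact ⟨c, h₁ hc, rfl⟩

/-- A realisation whose squared distances are all rational functions of its edge lengths is
quadratically solvable. If `o` and `w` are two vertices with `d(o,w) ≠ 0`, move `o` to the origin
and `w` to the first axis. Up to the factor `√d(o,w)`, the new coordinates of `v` are then the
scalar product and the determinant of the vectors from `o` to `w` and to `v`; scalar products, and
products of two such determinants, are polynomials in the squared distances. -/
theorem isQuadraticallySolvableAt_of_sqDist_mem {V : Type*} {G : SimpleGraph V}
    {p : Realisation ℂ V} (h : ∀ u v, sqDist p u v ∈ edgeField G p) :
    IsQuadraticallySolvableAt G p := by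
  suffices H : ∃ q : Realisation ℂ V, AreCongruent p q ∧ ∃ s c : ℂ, s ^ 2 ∈ edgeField G p ∧
      c ^ 2 ∈ edgeField G p ∧ ∀ M : IntermediateField ℚ ℂ, edgeField G p ≤ M → s ∈ M → c ∈ M →
        ∀ v i, q v i ∈ M by
    obtain ⟨q, hpq, s, c, hs, hc, hq⟩ := H
    obtain ⟨M, hM, hKM, hsM, hcM⟩ := exists_isQuadraticExtension_mem_mem hs hc
    refine ⟨q, hpq, edgeField_le_coordField G q, M, hpq.edgeField_eq G ▸ hM, ?_⟩
    refine IntermediateField.adjoin_le_iff.2 ?_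
    rintro _ ⟨v, i, rfl⟩
    exact hq M hKM hsM hcM v i
  by_cases h0 : ∀ u v, sqDist p u v = 0
  · -- All squared distances vanish: `p` is congruent to the realisation at a single point.
    exact ⟨fun _ _ ↦ 0, fun u v ↦ (h0 u v).trans (by simp [sqDist]), 0, 0, by simp, by simp,
      fun M _ _ _ _ _ ↦ zero_mem M⟩
  push Not at h0
  obtain ⟨o, w, how⟩ := h0
  obtain ⟨s, hs⟩ := IsAlgClosed.exists_pow_nat_eq (sqDist p o w) two_pos
  have hs0 : s ≠ 0 := by rintro rfl; exact how (by rw [← hs]; simp)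
  set K := edgeField G p
  let ip (u v : V) : ℂ :=
    (p u 0 - p o 0) * (p v 0 - p o 0) + (p u 1 - p o 1) * (p v 1 - p o 1)
  let cr (v : V) : ℂ := (p w 0 - p o 0) * (p v 1 - p o 1) - (p w 1 - p o 1) * (p v 0 - p o 0)
  have hip (u v : V) : ip u v ∈ K := by
    have : ip u v = (sqDist p o u + sqDist p o v - sqDist p u v) / 2 := by
      simp only [ip, sqDist]; ring
    rw [this]
    exact div_mem (sub_mem (add_mem (h _ _) (h _ _)) (h _ _)) (ofNat_mem K 2)
  have hcr (u v : V) : cr u * cr v ∈ K := by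
    have : cr u * cr v = ip w w * ip u v - ip w u * ip w v := by
      simp only [ip, cr]; ring
    rw [this]
    exact sub_mem (mul_mem (hip _ _) (hip _ _)) (mul_mem (hip _ _) (hip _ _))
  -- If all points are collinear, any `j` will do.
  obtain ⟨j, hj⟩ : ∃ j, cr j = 0 → ∀ v, cr v = 0 := by
    by_cases hne : ∃ j, cr j ≠ 0
    · obtain ⟨j, hj⟩ := hne
      exact ⟨j, fun h ↦ absurd h hj⟩
    · push Not at hne
      exact ⟨o, fun _ ↦ hne⟩
  refine ⟨fun v ↦ ![ip w v / s, cr v / s], fun u v ↦ ?_, s, cr j, hs ▸ h o w,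
    sq (cr j) ▸ hcr j j, fun M hKM hsM hcM v i ↦ ?_⟩
  · have : sqDist p u v * s ^ 2 = (ip w u - ip w v) ^ 2 + (cr u - cr v) ^ 2 := by
      rw [hs]; simp only [ip, cr, sqDist]; ring
    simp only [sqDist, Matrix.cons_val_zero, Matrix.cons_val_one] at this ⊢
    field_simp
    linear_combination this
  · have hcv : cr v ∈ M := by
      by_cases hj0 : cr j = 0
      · rw [hj hj0 v]; exact zero_mem M
      · rw [← mul_div_cancel_right₀ (cr v) hj0]
        exact div_mem (hKM (hcr v j)) hcM
    fin_cases i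
    · exact div_mem (hKM (hip w v)) hsM
    · exact div_mem hcv hsM

end PlaneFramework

theorem theorem5 {V : Type*} [Finite V] (G : SimpleGraph V)
    (hG : PlaneFramework.IsGloballyRigid G) :
    PlaneFramework.IsQuadraticallySolvable G := by
  -- Equivalent real realisations are congruent at any distance, so every `ε` works.
  refine ⟨fun p hp ↦ ⟨1, one_pos, fun q hq _ u v ↦ ?_⟩, fun p hp ↦
    PlaneFramework.isQuadraticallySolvableAt_of_sqDist_mem
      (hG.isGloballyRigidAt hp).sqDist_mem_edgeField⟩
  have hcast (p : PlaneFramework.Realisation ℝ V) (u v : V) :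
      PlaneFramework.sqDist (fun w i ↦ (p w i : ℂ)) u v = (PlaneFramework.sqDist p u v : ℝ) :=
    PlaneFramework.map_sqDist Complex.ofRealHom p u v
  have key := hG.isGloballyRigidAt hp.ofReal (fun w i ↦ (q w i : ℂ))
    (fun u v huv ↦ by rw [hcast, hcast, hq u v huv]) u v
  rw [hcast, hcast] at key
  exact Complex.ofReal_injective key
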